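/- Let $d\ge 1$ be odd. A path is a Lipschitz map $\mathbf{x}:[0,1]\to\mathbb{R}^d$; it is closed if $\mathbf{x}(0)=\mathbf{x}(1)$. A path is a $d$-order path if $$\det\begin{pmatrix}1&1&\cdots&1\\ \mathbf{x}(t_0)&\mathbf{x}(t_1)&\cdots&\mathbf{x}(t_d)\end{pmatrix}>0\qquad\text{for all }0\le t_0<t_1<\cdots<t_d\le 1,$$ and a path is cyclic if it is a uniform limit of $d$-order paths. Put $$\alpha^{(d)}(\mathbf{x})=\frac1{d!}\int_{0\le t_1<\cdots<t_d\le 1}\det\bigl(\mathbf{x}'(t_1),\dots,\mathbf{x}'(t_d)\bigr)\,dt_1\cdots dt_d .$$ 1. There is no closed cyclic path in $\mathbb{R}^d$ whose image is not contained in an affine hyperplane of $\mathbb{R}^d$. 2. More generally, if $\mathbf{x}$ is a closed path in $\mathbb{R}^d$ with $\operatorname{vol}(\operatorname{conv}(\mathbf{x}([0,1])))=\alpha^{(d)}(\mathbf{x})$, where $\operatorname{vol}$ is $d$-dimensional Lebesgue measure, then the image of $\mathbf{x}$ is contained in an affine hyperplane of $\mathbb{R}^d$. -/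

import Mathlib

open Set MeasureTheory Filter

noncomputable section

/-- A Lipschitz path `[0,1] → ℝ^d`. A path is a function on `ℝ` of which only the values on
`[0,1]` are used. -/
def IsLipschitzPath {d : ℕ} (x : ℝ → EuclideanSpace ℝ (Fin d)) : Prop :=
  ∃ K : NNReal, LipschitzOnWith K x (Icc 0 1)

/-- The path is closed: its start point and its end point coincide. -/
def IsClosedPath {d : ℕ} (x : ℝ → EuclideanSpace ℝ (Fin d)) : Prop :=
  x 0 = x 1

/-- The image of the path. -/
def pathImage {d : ℕ} (x : ℝ → EuclideanSpace ℝ (Fin d)) : Set (EuclideanSpace ℝ (Fin d)) :=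
  x '' Icc 0 1

/-- The matrix whose `j`-th column is `(1, x(t_j))`, for `j = 0, …, d`. -/
def orderMatrix {d : ℕ} (x : ℝ → EuclideanSpace ℝ (Fin d)) (t : Fin (d + 1) → ℝ) :
    Matrix (Fin (d + 1)) (Fin (d + 1)) ℝ :=
  Matrix.of fun i j => (Fin.cons 1 (fun k => x (t j) k) : Fin (d + 1) → ℝ) i

/-- `d`-order paths: Lipschitz paths with `det (1, x(t_j))_j > 0` for all
`0 ≤ t_0 < ⋯ < t_d ≤ 1`. -/
def IsOrderPath {d : ℕ} (x : ℝ → EuclideanSpace ℝ (Fin d)) : Prop :=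
  IsLipschitzPath x ∧
    ∀ t : Fin (d + 1) → ℝ, StrictMono t → (∀ j, t j ∈ Icc (0 : ℝ) 1) → 0 < (orderMatrix x t).det

/-- Cyclic paths: Lipschitz paths that are uniform limits on `[0,1]` of `d`-order paths. -/
def IsCyclicPath {d : ℕ} (x : ℝ → EuclideanSpace ℝ (Fin d)) : Prop :=
  IsLipschitzPath x ∧
    ∃ y : ℕ → ℝ → EuclideanSpace ℝ (Fin d),
      (∀ n, IsOrderPath (y n)) ∧ TendstoUniformlyOn y x atTop (Icc 0 1)

/-- The simplex `{0 ≤ t_1 < ⋯ < t_k ≤ 1}`. -/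
def orderedSimplex (k : ℕ) : Set (Fin k → ℝ) :=
  {t | StrictMono t ∧ ∀ i, t i ∈ Icc (0 : ℝ) 1}

/-- The top level alternating signature
`α^{(d)}(x) = (1/d!) ∫_{0 ≤ t_1 < ⋯ < t_d ≤ 1} det (x'(t_1), …, x'(t_d)) dt_1 ⋯ dt_d`.
The derivative of a Lipschitz path exists almost everywhere on `[0,1]` and is bounded there,
so that the integrand is integrable. -/
def alternatingSignature {d : ℕ} (x : ℝ → EuclideanSpace ℝ (Fin d)) : ℝ :=
  ((d.factorial : ℝ))⁻¹ *
    ∫ t in orderedSimplex d, (Matrix.of fun i j : Fin d => deriv x (t j) i).det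

/-- Affine hyperplanes of `ℝ^d`: the sets `{p | ⟨a, p⟩ = c}` with `a ≠ 0`. -/
def IsAffineHyperplane {d : ℕ} (H : Set (EuclideanSpace ℝ (Fin d))) : Prop :=
  ∃ (a : EuclideanSpace ℝ (Fin d)) (c : ℝ), a ≠ 0 ∧ H = {p | inner ℝ a p = c}

end

/-! Both parts rest on a sign that comes from `d` being odd. For a closed cyclic path, moving the
time 0 to the time 1 rotates the `d + 1` columns, an odd permutation. Both determinants are
nonnegative in the limit, so both vanish; but if the image spanned, some `d` times would give a
basis `x (t j) - x 0`. For a closed path, the signature itself vanishes (`setIntegral_det_eq_zero`),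
so the convex hull has volume zero and the affine span is proper. -/

/-- A set whose differences to a fixed point lie in a proper subspace lies in a hyperplane. -/
theorem exists_isAffineHyperplane_of_sub_mem {d : ℕ} {S : Set (EuclideanSpace ℝ (Fin d))}
    (p : EuclideanSpace ℝ (Fin d)) (W : Submodule ℝ (EuclideanSpace ℝ (Fin d))) (hW : W ≠ ⊤)
    (h : ∀ q ∈ S, q - p ∈ W) : ∃ H, IsAffineHyperplane H ∧ S ⊆ H := by
  have hW' : Wᗮ ≠ ⊥ := fun h0 => hW (Submodule.orthogonal_eq_bot_iff.1 h0)
  obtain ⟨a, haW, ha⟩ := Submodule.exists_mem_ne_zero_of_ne_bot hW'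
  refine ⟨_, ⟨a, inner ℝ a p, ha, rfl⟩, fun q hq => ?_⟩
  have := (Submodule.mem_orthogonal' W a).1 haW _ (h q hq)
  rw [inner_sub_right] at this
  exact sub_eq_zero.1 this

/-! ### Closed cyclic paths -/

theorem IsCyclicPath.det_nonneg {d : ℕ} {x : ℝ → EuclideanSpace ℝ (Fin d)} (hx : IsCyclicPath x)
    {t : Fin (d + 1) → ℝ} (ht : StrictMono t) (ht' : ∀ j, t j ∈ Icc (0 : ℝ) 1) :
    0 ≤ (orderMatrix x t).det := by
  obtain ⟨-, y, hy, hlim⟩ := hx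
  have hM : Tendsto (fun n => orderMatrix (y n) t) atTop (nhds (orderMatrix x t)) := by
    refine tendsto_pi_nhds.2 fun i => tendsto_pi_nhds.2 fun j => ?_
    refine Fin.cases ?_ (fun k => ?_) i
    · simp [orderMatrix]
    · have hk : Continuous fun p : EuclideanSpace ℝ (Fin d) => p k := by fun_prop
      simpa [orderMatrix, Function.comp_def] using
        (hk.tendsto _).comp (hlim.tendsto_at (ht' j))
  exact ge_of_tendsto (((continuous_id.matrix_det).tendsto _).comp hM)
    (Eventually.of_forall fun n => ((hy n).2 t ht ht').le)

/-- As `x 0 = x 1`, the matrices differ by a cycle of `d + 1` columns, of sign `(-1) ^ d = -1`. -/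
theorem det_orderMatrix_snoc {d : ℕ} (hd : Odd d) {x : ℝ → EuclideanSpace ℝ (Fin d)}
    (hc : IsClosedPath x) (t : Fin d → ℝ) :
    (orderMatrix x (Fin.snoc t 1)).det = -(orderMatrix x (Fin.cons 0 t)).det := by
  have h : orderMatrix x (Fin.snoc t 1) =
      (orderMatrix x (Fin.cons 0 t)).submatrix id (finRotate (d + 1)) := by
    have hx : x ∘ (Fin.snoc t 1 : Fin (d + 1) → ℝ) =
        fun j => x ((Fin.cons 0 t : Fin (d + 1) → ℝ) (finRotate (d + 1) j)) := by
      have h1 : x ∘ (Fin.snoc t 1 : Fin (d + 1) → ℝ) = Fin.snoc (x ∘ t) (x 1) :=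
        Fin.comp_snoc x t 1
      have h2 : x ∘ (Fin.cons 0 t : Fin (d + 1) → ℝ) = Fin.cons (x 0) (x ∘ t) :=
        Fin.comp_cons x 0 t
      rw [h1, Fin.snoc_eq_cons_rotate, ← hc, ← h2]
      rfl
    ext i j
    have := congrFun hx j
    simp only [Function.comp_apply] at this
    simp only [orderMatrix, Matrix.of_apply, Matrix.submatrix_apply, id, this]
  rw [h, Matrix.det_permute', sign_finRotate]
  simp [hd.neg_one_pow]

theorem IsCyclicPath.det_eq_zero {d : ℕ} (hd : Odd d) {x : ℝ → EuclideanSpace ℝ (Fin d)}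
    (hx : IsCyclicPath x) (hc : IsClosedPath x) {t : Fin d → ℝ} (ht : StrictMono t)
    (ht' : ∀ j, t j ∈ Ioo (0 : ℝ) 1) : (orderMatrix x (Fin.cons 0 t)).det = 0 := by
  have h1 : 0 ≤ (orderMatrix x (Fin.cons 0 t)).det := by
    refine hx.det_nonneg (Fin.strictMono_cons.2 ⟨fun j => (ht' j).1, ht⟩) fun j => ?_
    refine Fin.cases ?_ (fun k => ?_) j
    · simp
    · simpa using Ioo_subset_Icc_self (ht' k)
  have h2 : 0 ≤ (orderMatrix x (Fin.snoc t 1)).det := by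
    refine hx.det_nonneg ?_ fun j => ?_
    · rw [← Fin.insertNth_last', Fin.strictMono_insertNth_iff]
      exact ⟨ht, fun i _ => (ht' i).2, fun i hi => absurd hi (not_le.2 (Fin.castSucc_lt_last i))⟩
    · refine Fin.lastCases ?_ (fun k => ?_) j
      · simp
      · simpa using Ioo_subset_Icc_self (ht' k)
  rw [det_orderMatrix_snoc hd hc] at h2
  linarith

/-- A left kernel vector is an affine functional vanishing at all `d + 1` points; its linear part is
nonzero, since otherwise its constant term would vanish too. -/
theorem exists_inner_eq_zero_of_det_eq_zero {d : ℕ} {x : ℝ → EuclideanSpace ℝ (Fin d)}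
    {s : ℝ} {t : Fin d → ℝ} (h : (orderMatrix x (Fin.cons s t)).det = 0) :
    ∃ a : EuclideanSpace ℝ (Fin d), a ≠ 0 ∧ ∀ j, inner ℝ a (x (t j) - x s) = 0 := by
  obtain ⟨v, hv, hvM⟩ := Matrix.exists_vecMul_eq_zero_iff.2 h
  have key : ∀ j : Fin (d + 1),
      v 0 + ∑ k, v k.succ * x ((Fin.cons s t : Fin (d + 1) → ℝ) j) k = 0 := fun j => by
    have := congrFun hvM j
    simpa [Matrix.vecMul, dotProduct, Fin.sum_univ_succ, orderMatrix] using this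
  refine ⟨WithLp.toLp 2 fun k => v k.succ, fun h0 => hv ?_, fun j => ?_⟩
  · have h1 : ∀ k : Fin d, v k.succ = 0 := fun k => congrArg (fun w => w k) h0
    have h2 := key 0
    simp only [h1, zero_mul, Finset.sum_const_zero, add_zero] at h2
    exact funext fun i => Fin.cases h2 h1 i
  · have h1 := key j.succ
    have h2 := key 0
    simp only [Fin.cons_succ, Fin.cons_zero] at h1 h2
    simp only [PiLp.inner_apply, PiLp.sub_apply, RCLike.inner_apply, conj_trivial, sub_mul,
      Finset.sum_sub_distrib]
    simp only [mul_comm (v _)] at h1 h2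
    linarith

theorem exists_strictMono_basis_of_span_eq_top {d : ℕ} {x : ℝ → EuclideanSpace ℝ (Fin d)}
    (hc : IsClosedPath x)
    (h : Submodule.span ℝ ((fun s => x s - x 0) '' Icc (0 : ℝ) 1) = ⊤) :
    ∃ t : Fin d → ℝ, StrictMono t ∧ (∀ j, t j ∈ Ioo (0 : ℝ) 1) ∧
      Submodule.span ℝ (range fun j => x (t j) - x 0) = ⊤ := by
  obtain ⟨b, hb, hspan, hli⟩ :=
    exists_linearIndependent ℝ ((fun s => x s - x 0) '' Icc (0 : ℝ) 1)
  rw [h] at hspan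
  let B : Module.Basis b ℝ (EuclideanSpace ℝ (Fin d)) :=
    Module.Basis.mk hli (by simp [hspan])
  have : Finite b := Module.Finite.finite_basis B
  let e : Fin d ≃ b := (Finite.equivFinOfCardEq
    (by rw [← Module.finrank_eq_nat_card_basis B, finrank_euclideanSpace_fin])).symm
  choose s hs hsx using fun j => hb (e j).2
  have hinj : Function.Injective s := fun i j hij => by
    refine e.injective (Subtype.ext ?_)
    rw [← hsx i, ← hsx j, hij]
  have hne : ∀ j, x (s j) - x 0 ≠ 0 := fun j h0 => hli.ne_zero (e j) ((hsx j).symm.trans h0)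
  refine ⟨s ∘ Tuple.sort s, (Tuple.monotone_sort s).strictMono_of_injective
    (hinj.comp (Tuple.sort s).injective), fun j => ?_, ?_⟩
  -- The times 0 and 1 both give the zero vector, which no basis contains.
  · refine ⟨lt_of_le_of_ne (hs _).1 fun h0 => hne (Tuple.sort s j) ?_,
      lt_of_le_of_ne (hs _).2 fun h1 => hne (Tuple.sort s j) ?_⟩
    · simp only [Function.comp_apply] at h0
      rw [← h0, sub_self]
    · simp only [Function.comp_apply] at h1
      rw [h1, hc, sub_self]
  · rw [← hspan]
    congr 1
    calc range (fun j => x ((s ∘ Tuple.sort s) j) - x 0)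
        = range ((fun j => x (s j) - x 0) ∘ Tuple.sort s) := rfl
      _ = range fun j => x (s j) - x 0 := (Tuple.sort s).surjective.range_comp _
      _ = range (Subtype.val ∘ e) := congrArg range (funext hsx)
      _ = b := by rw [e.surjective.range_comp, Subtype.range_coe]

theorem exists_isAffineHyperplane_of_isCyclicPath {d : ℕ} (hd : Odd d)
    {x : ℝ → EuclideanSpace ℝ (Fin d)} (hx : IsCyclicPath x) (hc : IsClosedPath x) :
    ∃ H, IsAffineHyperplane H ∧ pathImage x ⊆ H := by
  refine exists_isAffineHyperplane_of_sub_mem (x 0)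
    (Submodule.span ℝ ((fun s => x s - x 0) '' Icc (0 : ℝ) 1)) (fun htop => ?_) ?_
  · obtain ⟨t, ht, ht', hspan⟩ := exists_strictMono_basis_of_span_eq_top hc htop
    obtain ⟨a, ha, h0⟩ := exists_inner_eq_zero_of_det_eq_zero (hx.det_eq_zero hd hc ht ht')
    have hle : Submodule.span ℝ (range fun j => x (t j) - x 0) ≤ (ℝ ∙ a)ᗮ := by
      rw [Submodule.span_le]
      rintro _ ⟨j, rfl⟩
      exact Submodule.mem_orthogonal_singleton_iff_inner_right.2 (h0 j)
    rw [hspan] at hle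
    exact ha (inner_self_eq_zero (𝕜 := ℝ).1
      (Submodule.mem_orthogonal_singleton_iff_inner_right.1 (hle (Submodule.mem_top (x := a)))))
  · rintro _ ⟨s, hs, rfl⟩
    exact Submodule.subset_span ⟨s, hs, rfl⟩

/-! ### Vanishing of the signature of closed paths -/

theorem measurableSet_orderedSimplex (k : ℕ) : MeasurableSet (orderedSimplex k) := by
  have : orderedSimplex k = (⋂ (i : Fin k) (j : Fin k) (_ : i < j), {t | t i < t j}) ∩
      ⋂ i : Fin k, (fun t => t i) ⁻¹' Icc (0 : ℝ) 1 := by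
    ext t
    simp [orderedSimplex, StrictMono]
  rw [this]
  refine .inter (.iInter fun i => .iInter fun j => .iInter fun _ =>
    measurableSet_lt (measurable_pi_apply i) (measurable_pi_apply j)) (.iInter fun i =>
    measurable_pi_apply i measurableSet_Icc)

theorem exists_strictMono_insertNth {n : ℕ} {s : Fin n → ℝ} (hs : StrictMono s) {u : ℝ}
    (hu : ∀ i, s i ≠ u) :
    ∃ k : Fin (n + 1), StrictMono (k.insertNth u s : Fin (n + 1) → ℝ) := by
  have hne : ∃ k : Fin (n + 1), ∀ i : Fin n, k ≤ i.castSucc → u < s i :=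
    ⟨Fin.last n, fun i hi => absurd hi (not_le.2 (Fin.castSucc_lt_last i))⟩
  -- The least such `k` is where `u` belongs in the sorted order.
  obtain ⟨k, hk, hmin⟩ := WellFounded.has_min (wellFounded_lt (α := Fin (n + 1)))
    {k | ∀ i : Fin n, k ≤ i.castSucc → u < s i} hne
  refine ⟨k, (Fin.strictMono_insertNth_iff _ _ _).2 ⟨hs, fun i hi => ?_, hk⟩⟩
  have h1 : ¬ ∀ j : Fin n, i.castSucc ≤ j.castSucc → u < s j := fun h => hmin _ h hi
  push Not at h1
  obtain ⟨j, hij, hj⟩ := h1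
  exact lt_of_le_of_ne ((hs.monotone (Fin.castSucc_le_castSucc_iff.1 hij)).trans hj) (hu i)

/-- The slices of `orderedSimplex (n + 1)` along the `k`-th coordinate, for all `k` together,
fill `[0, 1] × orderedSimplex n` up to a null set. -/
theorem iUnion_insertNth_preimage_ae_eq (n : ℕ) :
    (⋃ k : Fin (n + 1), {p : ℝ × (Fin n → ℝ) |
      (k.insertNth p.1 p.2 : Fin (n + 1) → ℝ) ∈ orderedSimplex (n + 1)}) =ᵐ[volume]
      Icc (0 : ℝ) 1 ×ˢ orderedSimplex n := by
  have hae : ∀ᵐ p : ℝ × (Fin n → ℝ), ∀ i, p.2 i ≠ p.1 := by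
    rw [ae_all_iff]
    intro i
    rw [Measure.volume_eq_prod, Measure.ae_prod_iff_ae_ae]
    · exact Eventually.of_forall fun u => Measure.ae_eval_ne (μ := fun _ : Fin n => (volume : Measure ℝ)) i u
    · exact (measurableSet_eq_fun (f := fun p : ℝ × (Fin n → ℝ) => p.2 i)
        ((measurable_pi_apply i).comp measurable_snd) measurable_fst).compl
  refine eventuallyEq_set.2 ?_
  filter_upwards [hae] with p hp
  simp only [mem_iUnion, mem_ofPred_eq, orderedSimplex, mem_prod]
  constructor
  · rintro ⟨k, hk, hk'⟩
    refine ⟨by simpa using hk' k, ((Fin.strictMono_insertNth_iff _ _ _).1 hk).1, fun i => ?_⟩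
    simpa using hk' (k.succAbove i)
  · rintro ⟨h1, h2, h3⟩
    obtain ⟨k, hk⟩ := exists_strictMono_insertNth h2 hp
    exact ⟨k, hk, (Fin.forall_iff_succAbove k).2 ⟨by simpa using h1, by simpa using h3⟩⟩

theorem pairwise_disjoint_insertNth_preimage (n : ℕ) :
    Pairwise (Function.onFun Disjoint fun k : Fin (n + 1) => {p : ℝ × (Fin n → ℝ) |
      (k.insertNth p.1 p.2 : Fin (n + 1) → ℝ) ∈ orderedSimplex (n + 1)}) := by
  have key : ∀ k l : Fin (n + 1), k < l → Disjoint {p : ℝ × (Fin n → ℝ) |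
      (k.insertNth p.1 p.2 : Fin (n + 1) → ℝ) ∈ orderedSimplex (n + 1)} {p : ℝ × (Fin n → ℝ) |
      (l.insertNth p.1 p.2 : Fin (n + 1) → ℝ) ∈ orderedSimplex (n + 1)} := by
    intro k l hkl
    refine Set.disjoint_left.2 fun p hp hq => ?_
    obtain ⟨-, -, h1⟩ := (Fin.strictMono_insertNth_iff _ _ _).1 hp.1
    obtain ⟨-, h2, -⟩ := (Fin.strictMono_insertNth_iff _ _ _).1 hq.1
    have hk : k ≠ Fin.last n := (hkl.trans_le (Fin.le_last l)).ne
    have e := Fin.castSucc_castPred k hk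
    exact lt_asymm (h1 (k.castPred hk) e.ge) (h2 (k.castPred hk) (e.le.trans_lt hkl))
  intro k l hkl
  rcases hkl.lt_or_gt with h | h
  · exact key k l h
  · exact (key l k h).symm

theorem integrable_det_of_integrable {n : ℕ} {g : Fin n → ℝ → ℝ} (hg : ∀ i, Integrable (g i)) :
    Integrable fun s : Fin n → ℝ => (Matrix.of fun i j => g i (s j)).det := by
  simp only [Matrix.det_apply, Matrix.of_apply]
  refine integrable_finsetSum _ fun σ _ => Integrable.smul _ ?_
  exact Integrable.fintype_prod (f := fun j u => g (σ j) u) fun j => hg _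

/-- Laplace expansion along column `k` gives `(-1) ^ k` times a function `G` independent of `k`.
Integrated over the `k`-th slice, `G` thus gives `(-1) ^ k` times the wanted integral. The slices
together fill `[0, 1] × orderedSimplex`, where `G` integrates to zero by Fubini. -/
theorem setIntegral_det_eq_zero {n : ℕ} (hn : Odd n) {g : Fin n → ℝ → ℝ}
    (hg : ∀ i, Integrable (g i)) (h0 : ∀ i, ∫ u in Icc (0 : ℝ) 1, g i u = 0) :
    ∫ t in orderedSimplex n, (Matrix.of fun i j => g i (t j)).det = 0 := by
  obtain _ | n := n
  · simp at hn
  set D : Fin (n + 1) → (Fin n → ℝ) → ℝ :=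
    fun i s => (Matrix.of fun a b => g (i.succAbove a) (s b)).det with hD
  set G : ℝ × (Fin n → ℝ) → ℝ := fun p => ∑ i : Fin (n + 1), (-1) ^ (i : ℕ) * (g i p.1 * D i p.2)
    with hG
  set A : Fin (n + 1) → Set (ℝ × (Fin n → ℝ)) := fun k => {p : ℝ × (Fin n → ℝ) |
      (k.insertNth p.1 p.2 : Fin (n + 1) → ℝ) ∈ orderedSimplex (n + 1)} with hA
  have hterm : ∀ i : Fin (n + 1), Integrable fun p : ℝ × (Fin n → ℝ) =>
      (-1) ^ (i : ℕ) * (g i p.1 * D i p.2) := fun i =>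
    ((hg i).mul_prod (integrable_det_of_integrable fun a => hg (i.succAbove a))).const_mul _
  have hGint : Integrable G := integrable_finsetSum _ fun i _ => hterm i
  have hdet : ∀ (k : Fin (n + 1)) (t : Fin (n + 1) → ℝ),
      (Matrix.of fun i j => g i (t j)).det =
        (-1) ^ (k : ℕ) * G (t k, fun j => t (k.succAbove j)) := by
    intro k t
    rw [Matrix.det_succ_column _ k, hG, Finset.mul_sum]
    refine Finset.sum_congr rfl fun i _ => ?_
    rw [pow_add, mul_comm ((-1 : ℝ) ^ (i : ℕ)), mul_assoc, mul_assoc]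
    rfl
  have hI : ∀ k : Fin (n + 1), ∫ p in A k, G p =
      (-1) ^ (k : ℕ) * ∫ t in orderedSimplex (n + 1), (Matrix.of fun i j => g i (t j)).det := by
    intro k
    have hpre : (MeasurableEquiv.piFinSuccAbove (fun _ : Fin (n + 1) => ℝ) k) ⁻¹' A k =
        orderedSimplex (n + 1) := by
      ext t
      simp only [hA, mem_preimage, mem_ofPred_eq]
      exact iff_of_eq (congrArg (· ∈ orderedSimplex (n + 1)) (Fin.insertNth_self_removeNth k t))
    rw [← (volume_preserving_piFinSuccAbove (fun _ : Fin (n + 1) => ℝ) k).setIntegral_preimage_emb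
      (MeasurableEquiv.measurableEmbedding _), hpre, ← integral_const_mul]
    refine integral_congr_ae (Eventually.of_forall fun t => ?_)
    simp only [hdet k t, ← mul_assoc, ← mul_pow]
    simp
    rfl
  have hAmeas : ∀ k, MeasurableSet (A k) := fun k =>
    (MeasurableEquiv.piFinSuccAbove (fun _ : Fin (n + 1) => ℝ) k).symm.measurable
      (measurableSet_orderedSimplex (n + 1))
  have hsum : ∑ k : Fin (n + 1), ∫ p in A k, G p = 0 := by
    rw [← integral_iUnion_fintype hAmeas (pairwise_disjoint_insertNth_preimage n)
      fun _ => hGint.integrableOn, setIntegral_congr_set (iUnion_insertNth_preimage_ae_eq n),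
      integral_finsetSum _ fun i _ => (hterm i).integrableOn]
    refine Finset.sum_eq_zero fun i _ => ?_
    rw [integral_const_mul, Measure.volume_eq_prod, setIntegral_prod_mul, h0, zero_mul, mul_zero]
  simp only [hI, ← Finset.sum_mul] at hsum
  -- The alternating sum has an odd number of terms, so the wanted integral survives with
  -- coefficient 1.
  have hone : ∑ k : Fin (n + 1), (-1 : ℝ) ^ (k : ℕ) = 1 := by
    rw [Fin.sum_univ_eq_sum_range (fun k => (-1 : ℝ) ^ k), neg_one_geom_sum,
      if_neg (Nat.not_even_iff_odd.2 hn)]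
  rwa [hone, one_mul] at hsum

theorem IsLipschitzPath.coord {d : ℕ} {x : ℝ → EuclideanSpace ℝ (Fin d)} (hx : IsLipschitzPath x)
    (i : Fin d) : AbsolutelyContinuousOnInterval (fun s => x s i) 0 1 := by
  obtain ⟨K, hK⟩ := hx
  refine LipschitzOnWith.absolutelyContinuousOnInterval (K := K) ?_
  rw [uIcc_of_le zero_le_one]
  refine LipschitzOnWith.of_dist_le_mul fun s hs t ht => ?_
  refine le_trans ?_ (hK.dist_le_mul s hs t ht)
  rw [dist_eq_norm, dist_eq_norm]
  exact PiLp.norm_apply_le (x s - x t) i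

/-- Needs all coordinates differentiable at once: elsewhere `deriv x s` is the default value 0. -/
theorem IsLipschitzPath.ae_deriv_coord {d : ℕ} {x : ℝ → EuclideanSpace ℝ (Fin d)}
    (hx : IsLipschitzPath x) (i : Fin d) :
    ∀ᵐ s : ℝ, s ∈ Icc (0 : ℝ) 1 → deriv (fun s => x s i) s = deriv x s i := by
  have : ∀ᵐ s : ℝ, ∀ i : Fin d, s ∈ Icc (0 : ℝ) 1 → DifferentiableAt ℝ (fun s => x s i) s := by
    rw [ae_all_iff]
    intro i
    filter_upwards [(hx.coord i).ae_differentiableAt] with s hs h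
    exact hs (by rwa [uIcc_of_le zero_le_one])
  filter_upwards [this] with s hs h
  have hd : DifferentiableAt ℝ x s := (differentiableAt_piLp 2).2 fun i => hs i h
  exact ((PiLp.proj (𝕜 := ℝ) 2 (fun _ : Fin d => ℝ) i).hasFDerivAt.comp_hasDerivAt s
    hd.hasDerivAt).deriv

theorem alternatingSignature_eq_zero {d : ℕ} (hd : Odd d) {x : ℝ → EuclideanSpace ℝ (Fin d)}
    (hx : IsLipschitzPath x) (hc : IsClosedPath x) : alternatingSignature x = 0 := by
  -- Cutting off outside `[0, 1]` gives integrability on all of `ℝ` and changes nothing on the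
  -- simplex.
  set g : Fin d → ℝ → ℝ := fun i => (Icc (0 : ℝ) 1).indicator fun s => deriv x s i with hgdef
  have hae : ∀ i, (fun s => deriv (fun s => x s i) s) =ᵐ[volume.restrict (Icc (0 : ℝ) 1)]
      fun s => deriv x s i := fun i =>
    (ae_restrict_iff' measurableSet_Icc).2 (hx.ae_deriv_coord i)
  have hg : ∀ i, Integrable (g i) := fun i => by
    rw [hgdef, integrable_indicator_iff measurableSet_Icc]
    refine Integrable.congr ?_ (hae i)
    exact (intervalIntegrable_iff_integrableOn_Icc_of_le zero_le_one).1
      (hx.coord i).intervalIntegrable_deriv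
  have h0 : ∀ i, ∫ u in Icc (0 : ℝ) 1, g i u = 0 := fun i => by
    rw [hgdef, setIntegral_indicator measurableSet_Icc, inter_self, ← integral_congr_ae (hae i),
      integral_Icc_eq_integral_Ioc, ← intervalIntegral.integral_of_le zero_le_one,
      (hx.coord i).integral_deriv_eq_sub, hc, sub_self]
  rw [alternatingSignature, ← setIntegral_det_eq_zero hd hg h0,
    setIntegral_congr_fun (measurableSet_orderedSimplex d)
      (g := fun t => (Matrix.of fun i j => g i (t j)).det), setIntegral_det_eq_zero hd hg h0,
    mul_zero]
  intro t ht
  simp only [hgdef, indicator_of_mem (ht.2 _)]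

/-! ### Hulls of volume zero -/

theorem exists_isAffineHyperplane_of_volume_eq_zero {d : ℕ} {x : ℝ → EuclideanSpace ℝ (Fin d)}
    (h : volume (convexHull ℝ (pathImage x)) = 0) :
    ∃ H, IsAffineHyperplane H ∧ pathImage x ⊆ H := by
  have hne : (pathImage x).Nonempty := ⟨x 0, 0, by simp, rfl⟩
  have hspan : affineSpan ℝ (pathImage x) ≠ ⊤ := fun htop => by
    have h1 := interior_convexHull_nonempty_iff_affineSpan_eq_top.2 htop
    exact (isOpen_interior.measure_pos volume h1).ne'
      (measure_mono_null interior_subset h)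
  have h0 : x 0 ∈ affineSpan ℝ (pathImage x) :=
    subset_affineSpan ℝ _ ⟨0, by simp, rfl⟩
  refine exists_isAffineHyperplane_of_sub_mem (x 0) (affineSpan ℝ (pathImage x)).direction
    (fun htop => hspan ((AffineSubspace.direction_eq_top_iff_of_nonempty ⟨_, h0⟩).1 htop)) ?_
  intro q hq
  exact AffineSubspace.vsub_mem_direction (subset_affineSpan ℝ _ hq) h0

theorem IsLipschitzPath.volume_convexHull_ne_top {d : ℕ} {x : ℝ → EuclideanSpace ℝ (Fin d)}
    (hx : IsLipschitzPath x) : volume (convexHull ℝ (pathImage x)) ≠ ⊤ := by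
  obtain ⟨K, hK⟩ := hx
  have : Bornology.IsBounded (pathImage x) :=
    (isCompact_Icc.image_of_continuousOn hK.continuousOn).isBounded
  exact (isBounded_convexHull.2 this).measure_lt_top.ne

theorem corollary4p6 (d : ℕ) (hd : Odd d) :
    (¬ ∃ x : ℝ → EuclideanSpace ℝ (Fin d),
      IsCyclicPath x ∧ IsClosedPath x ∧
        ¬ ∃ H : Set (EuclideanSpace ℝ (Fin d)), IsAffineHyperplane H ∧ pathImage x ⊆ H) ∧
    (∀ x : ℝ → EuclideanSpace ℝ (Fin d),
      IsLipschitzPath x → IsClosedPath x →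
      (volume (convexHull ℝ (pathImage x))).toReal = alternatingSignature x →
        ∃ H : Set (EuclideanSpace ℝ (Fin d)), IsAffineHyperplane H ∧ pathImage x ⊆ H) := by
  refine ⟨fun ⟨x, hx, hc, h⟩ => h (exists_isAffineHyperplane_of_isCyclicPath hd hx hc),
    fun x hx hc hvol => exists_isAffineHyperplane_of_volume_eq_zero ?_⟩
  rw [alternatingSignature_eq_zero hd hx hc, ENNReal.toReal_eq_zero_iff] at hvol
  -- `toReal` also sends `⊤` to 0, so finiteness of the volume is needed.
  exact hvol.resolve_right hx.volume_convexHull_ne_top
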